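/- Let $G=(V,E)$ be a finite simple undirected graph with $n=|V|\ge 2$ vertices, given by incidence lists: for every vertex $u$ its neighbors are listed without repetition in an arbitrary order and indexed $1,\dots,\deg(u)$. The graph is accessed only by the probes $\mathrm{degree}(u)$; $\mathrm{neighbor}(u,i)$, which gives the $i$-th neighbor of $u$ ($\bot$ if there is none); and $\mathrm{adjacency}(u,v)$, which gives $i$ if $v$ is the $i$-th neighbor of $u$, and $\bot$ if $u,v$ are not adjacent. Let $p\in[0,1]$. A data structure holds for each vertex $u$ an index $\mathbf{last}[u]$ (initially $0$) and a set $P_u$ of indices (initially empty). For integers $a<b$ let $F(u,a,b)$ be the law of the first index strictly between $a$ and $b$ that is kept, if each of these indices is kept independently with probability $p$, with value $b$ if none is kept. The query $\textsc{next-neighbor}(u)$ does the following. 1. $i\gets\mathbf{last}[u]$; $\;w\gets\min\bigl((P_u\cap(i,\deg(u)])\cup\{\deg(u)+1\}\bigr)$. 2. If $i\ne w$, repeat: draw a fresh sample $i\sim F(u,i,w)$ (with the current value of $i$ on the right); until $i=w$ or $\mathbf{last}[x]<\mathrm{adjacency}(x,u)$, where $x=\mathrm{neighbor}(u,i)$.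 3. $v\gets\mathrm{neighbor}(u,i)$. If $i\neq w$, then $P_u\gets P_u\cup\{i\}$ and $P_v\gets P_v\cup\{\mathrm{adjacency}(v,u)\}$. 4. $\mathbf{last}[u]\gets i$. Return $v$ if $i\le\deg(u)$, and $\bot$ otherwise. Each probe, each sample from $F$, and each read, look-up or update of the data structure (including the computation of the minimum in line 1) counts as one elementary step. Then for every $d>0$ there is a constant $C>0$, depending only on $d$, such that the following holds for all such $G$ (with any incidence lists), all $p\in[0,1]$, every $T$, and every user who makes $T$ successive $\textsc{next-neighbor}$ queries on one initially empty data structure, where each queried vertex may depend on the answers to the earlier queries and on their costs. The run can be realized jointly with a random skeleton $G'$ of $G$, in which each edge of $G$ is kept independently with probability $p$, such that: (a) (consistency) With $N_{G'}(u)$ ordered as in the list of $u$ in $G$, for every $u$ and every $t\ge 1$ the $t$-th query on $u$ returns the $t$-th element of $N_{G'}(u)$ if $t\le|N_{G'}(u)|$, and $\bot$ if $t>|N_{G'}(u)|$. In particular the first $|N_{G'}(u)|+1$ queries on $u$ return all of $N_{G'}(u)$ in order, and then $\bot$. (b) (complexity) With probability at least $1-n^{-d}$, every one of the $T$ queries takes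 at most $C\log n$ probes and at most $C\log n$ elementary steps, and for every $u$ that is queried at least $|N_{G'}(u)|+1$ times, the first $|N_{G'}(u)|+1$ queries on $u$, which recover $N_{G'}(u)$, take in total at most $C\,(|N_{G'}(u)|+1)\log n$ probes and at most $C\,(|N_{G'}(u)|+1)\log n$ elementary steps. -/

import Mathlib

open scoped NNReal ENNReal

/-- An incidence-list representation of the simple graph `G`: for every vertex `u` a list of the
neighbors of `u`, without repetitions, in an arbitrary order. -/
structure IncidenceList {V : Type*} (G : SimpleGraph V) where
  nbrs : V → List V
  nodup : ∀ u, (nbrs u).Nodup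
  mem_iff : ∀ u v, v ∈ nbrs u ↔ G.Adj u v

namespace IncidenceList

variable {V : Type*} {G : SimpleGraph V} (L : IncidenceList G)

/-- The degree probe. -/
def degree (u : V) : ℕ := (L.nbrs u).length

/-- The neighbor probe: the `i`-th neighbor of `u`, for `1 ≤ i ≤ deg u`, and `⊥` otherwise. -/
def neighbor (u : V) (i : ℕ) : Option V := if i = 0 then none else (L.nbrs u)[i - 1]?

/-- The adjacency probe: `i` if `v` is the `i`-th neighbor of `u` (counted from `1`),
and `⊥` if `u` and `v` are not adjacent. -/
def adjacency [DecidableEq V] (u v : V) : Option ℕ :=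
  if v ∈ L.nbrs u then some ((L.nbrs u).idxOf v + 1) else none

open Classical in
/-- The neighbors of `u` in a subgraph `H` of `G`, in the order in which `G` lists them. -/
noncomputable def nbrsIn (H : SimpleGraph V) (u : V) : List V :=
  (L.nbrs u).filter fun v => H.Adj u v

end IncidenceList

/-- A coin that shows `true` with probability `p`. -/
noncomputable def coin (p : ℝ≥0) (hp : p ≤ 1) : PMF Bool :=
  PMF.ofFintype (fun b => if b then (p : ℝ≥0∞) else 1 - p) (by
    simp [add_tsub_cancel_of_le (show (p : ℝ≥0∞) ≤ 1 by exact_mod_cast hp)])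

open Classical in
/-- The law of the set of kept edges when every edge of `G` is kept independently with
probability `p`. -/
noncomputable def keptEdgesLaw {V : Type*} [Fintype V] (G : SimpleGraph V) (p : ℝ≥0)
    (hp : p ≤ 1) : PMF (Finset (Sym2 V)) :=
  PMF.ofFinset
    (fun S => if S ⊆ G.edgeFinset then
      (p : ℝ≥0∞) ^ S.card * (1 - (p : ℝ≥0∞)) ^ (G.edgeFinset.card - S.card) else 0)
    G.edgeFinset.powerset
    (by
      rw [Finset.sum_congr rfl fun S hS => if_pos (Finset.mem_powerset.1 hS),
        Finset.sum_pow_mul_eq_add_pow,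
        add_tsub_cancel_of_le (show (p : ℝ≥0∞) ≤ 1 by exact_mod_cast hp), one_pow])
    (fun S hS => if_neg fun h => hS (Finset.mem_powerset.2 h))

/-- The law of the random skeleton of `G` with edge probability `p`. -/
noncomputable def skeletonLaw {V : Type*} [Fintype V] (G : SimpleGraph V) (p : ℝ≥0)
    (hp : p ≤ 1) : PMF (SimpleGraph V) :=
  (keptEdgesLaw G p hp).map fun S => SimpleGraph.fromEdgeSet (S : Set (Sym2 V))

/-- `firstKept p hp a g` scans the `g` indices `a + 1, …, a + g`, keeps each of them independently
with probability `p`, and returns the first one that is kept, or `a + g + 1` if none is. -/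
noncomputable def firstKept (p : ℝ≥0) (hp : p ≤ 1) (a : ℕ) : ℕ → PMF ℕ
  | 0 => PMF.pure (a + 1)
  | g + 1 => (coin p hp).bind fun c =>
      if c then PMF.pure (a + 1) else firstKept p hp (a + 1) g

/-- The law `F(u, a, b)`, for `a < b`, of the first kept index strictly between `a` and `b`,
with value `b` if there is none. All these indices are treated as undecided. -/
noncomputable def nextIndexLaw (p : ℝ≥0) (hp : p ≤ 1) (a b : ℕ) : PMF ℕ :=
  firstKept p hp a (b - a - 1)

/-- Programs that work on an input graph with vertex set `V` and on the auxiliary data structure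
(an array `last` of indices and for every vertex a set `P` of indices). The input graph is reached
through the probes `degree`, `neighbor` and `adjacency` only. Each constructor but `ret` is one
elementary operation, followed by a continuation that receives its answer. -/
inductive Prog (V : Type*) (α : Type*) where
  /-- stop with a result -/
  | ret (a : α)
  /-- degree probe -/
  | degree (u : V) (k : ℕ → Prog V α)
  /-- neighbor probe -/
  | neighbor (u : V) (i : ℕ) (k : Option V → Prog V α)
  /-- adjacency probe -/
  | adjacency (u v : V) (k : Option ℕ → Prog V α)
  /-- draw a fresh sample from `F(·, a, b)` -/
  | sample (a b : ℕ) (k : ℕ → Prog V α)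
  /-- read `last[u]` -/
  | readLast (u : V) (k : ℕ → Prog V α)
  /-- `last[u] ← i` -/
  | writeLast (u : V) (i : ℕ) (k : Prog V α)
  /-- look up `min ((P_u ∩ (a, b]) ∪ {b + 1})` -/
  | leastKnown (u : V) (a b : ℕ) (k : ℕ → Prog V α)
  /-- `P_u ← P_u ∪ {i}` -/
  | insertKnown (u : V) (i : ℕ) (k : Prog V α)

/-- The data structure: `last u` is the (`1`-based) index in the neighbor list of `u` of the
neighbor of `u` that was returned last, and `known u` is the set of the indices of the known
neighbors of `u` in the skeleton. -/
structure DataStr (V : Type*) where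
  last : V → ℕ
  known : V → Finset ℕ

/-- The initial state: nothing was returned and nothing is known. -/
def DataStr.init (V : Type*) : DataStr V := ⟨fun _ => 0, fun _ => ∅⟩

/-- `DataStr.leastKnown s u a b = min ((P_u ∩ (a, b]) ∪ {b + 1})`. -/
def DataStr.leastKnown {V : Type*} (s : DataStr V) (u : V) (a b : ℕ) : ℕ :=
  (insert (b + 1) (s.known u ∩ Finset.Ioc a b)).min' (Finset.insert_nonempty _ _)

/-- What one execution of a program yields: its result, the final state, the number of probes to
the graph, and the number of all elementary operations (the probes included). -/
structure Outcome (V : Type*) (α : Type*) where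
  result : α
  state : DataStr V
  probes : ℕ
  steps : ℕ

/-- Count one more probe. -/
def Outcome.addProbe {V α : Type*} (o : Outcome V α) : Outcome V α :=
  { o with probes := o.probes + 1, steps := o.steps + 1 }

/-- Count one more elementary operation that is not a probe. -/
def Outcome.addStep {V α : Type*} (o : Outcome V α) : Outcome V α :=
  { o with steps := o.steps + 1 }

/-- Execution of a program on the graph given by `L`, from a given state. -/
noncomputable def Prog.exec {V α : Type*} [DecidableEq V] {G : SimpleGraph V}
    (L : IncidenceList G) (p : ℝ≥0) (hp : p ≤ 1) : Prog V α → DataStr V → PMF (Outcome V α)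
  | .ret a, s => PMF.pure ⟨a, s, 0, 0⟩
  | .degree u k, s => ((k (L.degree u)).exec L p hp s).map Outcome.addProbe
  | .neighbor u i k, s => ((k (L.neighbor u i)).exec L p hp s).map Outcome.addProbe
  | .adjacency u v k, s => ((k (L.adjacency u v)).exec L p hp s).map Outcome.addProbe
  | .sample a b k, s =>
      ((nextIndexLaw p hp a b).bind fun i => (k i).exec L p hp s).map Outcome.addStep
  | .readLast u k, s => ((k (s.last u)).exec L p hp s).map Outcome.addStep
  | .writeLast u i k, s =>
      (k.exec L p hp { s with last := Function.update s.last u i }).map Outcome.addStep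
  | .leastKnown u a b k, s => ((k (s.leastKnown u a b)).exec L p hp s).map Outcome.addStep
  | .insertKnown u i k, s =>
      (k.exec L p hp { s with known := Function.update s.known u (insert i (s.known u)) }).map
        Outcome.addStep

/-- The loop of the next-neighbor query on `u`: starting from the index `v < w`, replace `v` by a
sample `i` of `F(u, v, w)` until `i = w` or the `i`-th neighbor `x` of `u` has not yet passed `u`,
that is, `last[x]` is smaller than the index of `u` in the list of `x`. Samples lie in `(v, w]`,
so the test `v < i ∧ i < w` says `i ≠ w`; the `none` branches are never reached. -/
def searchLoop {V α : Type*} (u : V) (w : ℕ) (k : ℕ → Prog V α) (v : ℕ) : Prog V α :=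
  .sample v w fun i =>
    if _h : v < i ∧ i < w then
      .neighbor u i fun
        | none => k w
        | some x => .adjacency x u fun
          | none => k w
          | some j => .readLast x fun l =>
              if j ≤ l then searchLoop u w k i else k i
    else k w
termination_by w - v
decreasing_by omega

/-- The next-neighbor query on `u`. -/
def nextNeighbor {V : Type*} (u : V) : Prog V (Option V) :=
  .readLast u fun v =>
  .degree u fun d =>
  .leastKnown u v d fun w =>
  let finish (i : ℕ) : Prog V (Option V) :=
    .neighbor u i fun x =>
    let output : Prog V (Option V) := .writeLast u i (.ret (if i ≤ d then x else none))
    if i ≠ w then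
      match x with
      | none => output
      | some y => .insertKnown u i (.adjacency y u fun
          | none => output
          | some j => .insertKnown y j output)
    else output
  if v ≠ w then searchLoop u w finish v else finish v

/-- The record of one next-neighbor query: the vertex that was queried, the answer, the number of
probes to the graph and the number of all elementary operations. -/
structure QueryRecord (V : Type*) where
  vertex : V
  answer : Option V
  probes : ℕ
  steps : ℕ

/-- `T` successive next-neighbor queries on one data structure that is empty at the start. The user
chooses each query, by the rule `σ`, from the records of all earlier ones. -/
noncomputable def interact {V : Type*} [DecidableEq V] {G : SimpleGraph V}
    (L : IncidenceList G) (p : ℝ≥0) (hp : p ≤ 1) (σ : List (QueryRecord V) → V) :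
    ℕ → PMF (List (QueryRecord V) × DataStr V)
  | 0 => PMF.pure ([], DataStr.init V)
  | T + 1 => (interact L p hp σ T).bind fun hs =>
      ((nextNeighbor (σ hs.1)).exec L p hp hs.2).map fun o =>
        (hs.1 ++ [⟨σ hs.1, o.result, o.probes, o.steps⟩], o.state)

/-- The law of the records of the first `T` queries, in the order in which they are made. -/
noncomputable def transcriptLaw {V : Type*} [DecidableEq V] {G : SimpleGraph V}
    (L : IncidenceList G) (p : ℝ≥0) (hp : p ≤ 1) (σ : List (QueryRecord V) → V) (T : ℕ) :
    PMF (List (QueryRecord V)) :=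
  (interact L p hp σ T).map Prod.fst

/-- The records of the queries on `u`. -/
def queriesOn {V : Type*} [DecidableEq V] (u : V) (h : List (QueryRecord V)) :
    List (QueryRecord V) :=
  h.filter fun r => r.vertex = u

/-- The answers in `h` are those of next-neighbor access to `H`: for every `u`, the `t`-th query on
`u` (from `t = 0`) returns the `t`-th element of the ordered neighborhood of `u` in `H`, and `⊥` once
all of them have been returned. -/
def AnswersFrom {V : Type*} [DecidableEq V] {G : SimpleGraph V} (L : IncidenceList G)
    (H : SimpleGraph V) (h : List (QueryRecord V)) : Prop :=
  ∀ (u : V) (t : ℕ) (r : QueryRecord V), (queriesOn u h)[t]? = some r →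
    r.answer = (L.nbrsIn H u)[t]?

/-! The proof defers decisions. Every use of randomness gets a named coin: `inl e` decides whether
the edge `e` is kept, and a "ghost" coin `inr (u, x)` is used when a search from `u` meets a
neighbor `x` whose own search has already passed `u`, so that the edge is settled. Samples from `F`
become scans over such coins (`execTree`, `interactTree`). No coin is flipped twice
(`fresh_interactTree`), so flipping all of them in advance gives the same law of the run
(`CoinTree.Fresh.map_eval`). The edge coins then form the skeleton, which yields the coupling.

For fixed coins `ω` everything is deterministic. A query moves to the next edge of `ω`, because an
edge decided from the other side either was kept and is then in the known set, or was dropped and is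
rejected by the `last` test (`Consistent.eval_nextNeighbor`). Each rejected sample is a ghost coin
showing `true` before the next kept edge. At each neighbor, a true ghost on a dropped edge is at
most as likely as a kept edge, so seeing `k` ghosts first has probability at most `2⁻¹ ^ k`
(`law_ghostTree_le`).

The ghost count depends only on `ω`, the vertex and the starting index. A union bound over `n ^ 2`
pairs therefore covers every adaptive user and every number of queries. -/

theorem PMF.map_congr_of_support {α β : Type*} (q : PMF α) {f g : α → β}
    (h : ∀ a ∈ q.support, f a = g a) : q.map f = q.map g := by
  ext y
  rw [PMF.map_apply, PMF.map_apply]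
  refine tsum_congr fun a => ?_
  by_cases ha : a ∈ q.support
  · rw [h a ha]
  · simp [(PMF.apply_eq_zero_iff q a).2 ha]

/-! ### Random subsets with independent elements -/

open Classical in
/-- The law of the random subset of `K` that keeps each element independently with
probability `p`. -/
noncomputable def subsetLaw {κ : Type*} (p : ℝ≥0) (hp : p ≤ 1) (K : Finset κ) :
    PMF (Finset κ) :=
  PMF.ofFinset
    (fun S => if S ⊆ K then (p : ℝ≥0∞) ^ S.card * (1 - (p : ℝ≥0∞)) ^ (K.card - S.card) else 0)
    K.powerset
    (by
      rw [Finset.sum_congr rfl fun S hS => if_pos (Finset.mem_powerset.1 hS),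
        Finset.sum_pow_mul_eq_add_pow,
        add_tsub_cancel_of_le (show (p : ℝ≥0∞) ≤ 1 by exact_mod_cast hp), one_pow])
    (fun S hS => if_neg fun h => hS (Finset.mem_powerset.2 h))

section SubsetLaw

variable {κ : Type*} (p : ℝ≥0) (hp : p ≤ 1)

open Classical in
theorem subsetLaw_apply (K S : Finset κ) :
    subsetLaw p hp K S =
      if S ⊆ K then (p : ℝ≥0∞) ^ S.card * (1 - (p : ℝ≥0∞)) ^ (K.card - S.card) else 0 := rfl

theorem subset_of_mem_support_subsetLaw {K S : Finset κ}
    (h : S ∈ (subsetLaw p hp K).support) : S ⊆ K := by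
  classical
  by_contra hS
  exact (PMF.mem_support_iff _ _).1 h (by rw [subsetLaw_apply, if_neg hS])

theorem keptEdgesLaw_eq_subsetLaw {V : Type*} [Fintype V] (G : SimpleGraph V)
    {K : Finset (Sym2 V)} (hK : ∀ e, e ∈ K ↔ e ∈ G.edgeSet) :
    keptEdgesLaw G p hp = subsetLaw p hp K := by
  classical
  obtain rfl : K = G.edgeFinset := by ext e; simp [hK]
  ext S
  rw [subsetLaw_apply]
  simp only [keptEdgesLaw, PMF.ofFinset_apply]
  congr

theorem coin_bind_apply {β : Type*} (f : Bool → PMF β) (y : β) :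
    (coin p hp).bind f y = p * f true y + (1 - p) * f false y := by
  rw [PMF.bind_apply, tsum_fintype, Fintype.sum_bool]
  simp [coin]

theorem coin_bind_toOuterMeasure {β : Type*} (f : Bool → PMF β) (s : Set β) :
    ((coin p hp).bind f).toOuterMeasure s =
      p * (f true).toOuterMeasure s + (1 - p) * (f false).toOuterMeasure s := by
  rw [PMF.toOuterMeasure_bind_apply, tsum_fintype, Fintype.sum_bool]
  simp [coin]

theorem subsetLaw_empty : subsetLaw p hp (∅ : Finset κ) = PMF.pure ∅ := by
  classical
  ext S
  rw [subsetLaw_apply, PMF.pure_apply]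
  by_cases h : S = ∅ <;> simp [h]

/-- Reveals a single coin; this is the recursion behind every later induction on `subsetLaw`. -/
theorem subsetLaw_insert [DecidableEq κ] {c : κ} {K : Finset κ} (hc : c ∉ K) :
    subsetLaw p hp (insert c K) = (coin p hp).bind fun b =>
      (subsetLaw p hp K).map fun S => if b then insert c S else S := by
  ext S
  rw [coin_bind_apply]
  simp only [if_true, Bool.false_eq_true, if_false]
  rw [show (fun S : Finset κ => S) = id from rfl, PMF.map_id]
  by_cases hS : c ∈ S
  · have h1 : ∀ X : Finset κ, (if S = insert c X then subsetLaw p hp K X else 0) =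
        if X = S.erase c then subsetLaw p hp K X else 0 := by
      intro X
      by_cases hX : X ⊆ K
      · have hcX : c ∉ X := fun h => hc (hX h)
        have : S = insert c X ↔ X = S.erase c := by
          constructor
          · rintro rfl; rw [Finset.erase_insert hcX]
          · rintro rfl; rw [Finset.insert_erase hS]
        simp only [this]
      · simp [subsetLaw_apply, hX]
    have h2 : (subsetLaw p hp K).map (fun X => insert c X) S =
        subsetLaw p hp K (S.erase c) := by
      rw [PMF.map_apply, ← tsum_ite_eq (S.erase c) (subsetLaw p hp K)]
      exact tsum_congr fun X => by convert h1 X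
    have hcard : (S.erase c).card + 1 = S.card := Finset.card_erase_add_one hS
    have hSK : ¬ S ⊆ K := fun h => hc (h hS)
    have hiff : S ⊆ insert c K ↔ S.erase c ⊆ K := Finset.subset_insert_iff
    have h3 : subsetLaw p hp K S = 0 := by rw [subsetLaw_apply, if_neg hSK]
    refine Eq.trans ?_ (congrArg₂ (fun x y => (p : ℝ≥0∞) * x + (1 - p) * y) h2.symm h3.symm)
    simp only [subsetLaw_apply, mul_zero, add_zero, hiff, Finset.card_insert_of_notMem hc]
    split_ifs
    · rw [← hcard, pow_succ, Nat.add_sub_add_right]; ring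
    · simp
  · have h1 : ∀ X : Finset κ, (if S = insert c X then subsetLaw p hp K X else 0) = 0 := by
      intro X
      rw [if_neg]
      rintro rfl
      exact hS (Finset.mem_insert_self _ _)
    have h2 : (subsetLaw p hp K).map (fun X => insert c X) S = 0 := by
      rw [PMF.map_apply]
      exact (tsum_congr fun X => by convert h1 X).trans tsum_zero
    have hiff : S ⊆ insert c K ↔ S ⊆ K := Finset.subset_insert_iff_of_notMem hS
    refine Eq.trans ?_ (congrArg (fun x => (p : ℝ≥0∞) * x + (1 - p) * subsetLaw p hp K S) h2.symm)
    simp only [subsetLaw_apply, mul_zero, zero_add, hiff, Finset.card_insert_of_notMem hc]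
    split_ifs with h
    · rw [Nat.sub_add_comm (Finset.card_le_card h), pow_succ]; ring
    · simp

/-- Forgetting the right-hand coins integrates them out; this later gives the skeleton marginal. -/
theorem map_toLeft_subsetLaw {κ' : Type*} [DecidableEq κ] [DecidableEq κ'] (A : Finset κ)
    (B : Finset κ') :
    (subsetLaw p hp (A.disjSum B)).map Finset.toLeft = subsetLaw p hp A := by
  induction B using Finset.induction_on with
  | empty =>
    induction A using Finset.induction_on with
    | empty =>
      simp only [Finset.disjSum_empty, Finset.map_empty, subsetLaw_empty, PMF.pure_map]
      rfl
    | insert a A ha ih =>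
      have h : (insert a A).disjSum (∅ : Finset κ') = insert (Sum.inl a) (A.disjSum ∅) := by
        ext x; cases x <;> simp
      rw [h, subsetLaw_insert p hp (by simpa using ha), subsetLaw_insert p hp ha, ← ih,
        PMF.map_bind]
      congr 1
      funext b
      rw [PMF.map_comp, PMF.map_comp]
      congr 1
      funext S
      cases b <;> simp
  | insert a B ha ih =>
    have h : A.disjSum (insert a B) = insert (Sum.inr a) (A.disjSum B) := by
      ext x; cases x <;> simp
    rw [h, subsetLaw_insert p hp (by simpa using ha), PMF.map_bind]
    have : ∀ b : Bool, PMF.map Finset.toLeft ((subsetLaw p hp (A.disjSum B)).map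
        fun S => if b then insert (Sum.inr a) S else S) = subsetLaw p hp A := by
      intro b
      rw [PMF.map_comp, ← ih]
      congr 1
      funext S
      cases b <;> simp
    simp only [this, PMF.bind_const]

end SubsetLaw

/-! ### Decision trees and deferred decisions -/

/-- Decision trees that flip named coins. -/
inductive CoinTree (κ : Type*) (α : Type*) where
  /-- stop with a result -/
  | ret (a : α)
  /-- flip the coin `c` and continue -/
  | flip (c : κ) (k : Bool → CoinTree κ α)

namespace CoinTree

variable {κ α β : Type*}

/-- Sequential composition. -/
def bind : CoinTree κ α → (α → CoinTree κ β) → CoinTree κ β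
  | ret a, f => f a
  | flip c k, f => flip c fun b => (k b).bind f

/-- The law of the result when every flip is a fresh coin. -/
noncomputable def law (p : ℝ≥0) (hp : p ≤ 1) : CoinTree κ α → PMF α
  | ret a => PMF.pure a
  | flip _ k => (coin p hp).bind fun b => (k b).law p hp

/-- The result when exactly the coins in `ω` show `true`. -/
def eval [DecidableEq κ] (ω : Finset κ) : CoinTree κ α → α
  | ret a => a
  | flip c k => (k (decide (c ∈ ω))).eval ω

/-- Every coin that is flipped is still available, starting from the supply `K`, and the result
and the remaining supply satisfy `Q`. -/
def Fresh (Q : α → Set κ → Prop) : CoinTree κ α → Set κ → Prop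
  | ret a, K => Q a K
  | flip c k, K => c ∈ K ∧ ∀ b, (k b).Fresh Q (K \ {c})

theorem law_bind (p : ℝ≥0) (hp : p ≤ 1) (t : CoinTree κ α) (f : α → CoinTree κ β) :
    (t.bind f).law p hp = (t.law p hp).bind fun a => (f a).law p hp := by
  induction t with
  | ret a => simp [bind, law]
  | flip c k ih => simp only [bind, law, ih, PMF.bind_bind]

theorem eval_bind [DecidableEq κ] (ω : Finset κ) (t : CoinTree κ α) (f : α → CoinTree κ β) :
    (t.bind f).eval ω = (f (t.eval ω)).eval ω := by
  induction t with
  | ret a => rfl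
  | flip c k ih => exact ih _

theorem Fresh.mono {Q Q' : α → Set κ → Prop} (hQ : ∀ a K, Q a K → Q' a K) {t : CoinTree κ α}
    {K : Set κ} (h : t.Fresh Q K) : t.Fresh Q' K := by
  induction t generalizing K with
  | ret a => exact hQ _ _ h
  | flip c k ih => exact ⟨h.1, fun b => ih b (h.2 b)⟩

theorem Fresh.bind {Q : α → Set κ → Prop} {Q' : β → Set κ → Prop} {t : CoinTree κ α}
    {f : α → CoinTree κ β} {K : Set κ} (h : t.Fresh Q K)
    (hf : ∀ a K, Q a K → (f a).Fresh Q' K) : (t.bind f).Fresh Q' K := by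
  induction t generalizing K with
  | ret a => exact hf _ _ h
  | flip c k ih => exact ⟨h.1, fun b => ih b (h.2 b)⟩

theorem Fresh.eval_congr [DecidableEq κ] {Q : α → Set κ → Prop} {t : CoinTree κ α} {K : Set κ}
    (h : t.Fresh Q K) {ω ω' : Finset κ} (hω : ∀ c ∈ K, c ∈ ω ↔ c ∈ ω') :
    t.eval ω = t.eval ω' := by
  induction t generalizing K with
  | ret a => rfl
  | flip c k ih =>
    simp only [eval, hω c h.1]
    exact ih _ (h.2 _) fun c' hc' => hω c' hc'.1

/-- Deferred decisions: flipping each available coin in advance yields the same law. -/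
theorem Fresh.map_eval [DecidableEq κ] (p : ℝ≥0) (hp : p ≤ 1) {Q : α → Set κ → Prop}
    {t : CoinTree κ α} {K : Finset κ} (h : t.Fresh Q (K : Set κ)) :
    (subsetLaw p hp K).map (fun ω => t.eval ω) = t.law p hp := by
  induction t generalizing K with
  | ret a => exact PMF.map_const _ _
  | flip c k ih =>
    have hc : c ∈ K := h.1
    rw [← Finset.insert_erase hc, subsetLaw_insert p hp (Finset.notMem_erase c K), PMF.map_bind,
      law]
    congr 1
    funext b
    have hk : (k b).Fresh Q ((K.erase c : Finset κ) : Set κ) := by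
      rw [Finset.coe_erase]; exact h.2 b
    rw [← ih b hk, PMF.map_comp]
    -- Only subsets of `K.erase c` matter, and these do not contain `c`.
    refine PMF.map_congr_of_support _ fun S hS => ?_
    have hcS : c ∉ S := fun h =>
      Finset.notMem_erase c K (subset_of_mem_support_subsetLaw p hp hS h)
    cases b with
    | false => simp [eval, hcS]
    | true =>
      simp only [Function.comp_apply, if_true, eval, Finset.mem_insert_self, decide_true]
      -- The continuation cannot ask for `c` again, so inserting `c` does not change its value.
      refine hk.eval_congr fun c' hc' => ?_
      have : c' ≠ c := (Finset.mem_erase.1 hc').1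
      simp [this]

end CoinTree

/-! ### Positions in incidence lists -/

namespace IncidenceList

variable {V : Type*} {G : SimpleGraph V} (L : IncidenceList G)

theorem neighbor_succ (u : V) (i : ℕ) : L.neighbor u (i + 1) = (L.nbrs u)[i]? := by
  simp [neighbor]

theorem exists_neighbor {u : V} {i : ℕ} (h0 : 0 < i) (hi : i ≤ L.degree u) :
    ∃ x, L.neighbor u i = some x := by
  obtain ⟨j, rfl⟩ : ∃ j, i = j + 1 := ⟨i - 1, by omega⟩
  exact ⟨_, (L.neighbor_succ u j).trans (List.getElem?_eq_getElem hi)⟩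

theorem neighbor_eq_none {u : V} {i : ℕ} (hi : L.degree u < i) : L.neighbor u i = none := by
  obtain ⟨j, rfl⟩ : ∃ j, i = j + 1 := ⟨i - 1, by omega⟩
  rw [neighbor_succ]
  exact List.getElem?_eq_none (Nat.lt_succ_iff.1 hi)

theorem mem_nbrs_comm {u x : V} : x ∈ L.nbrs u ↔ u ∈ L.nbrs x := by
  rw [L.mem_iff, L.mem_iff, G.adj_comm]

variable [DecidableEq V]

/-- The index of `x` in the list of `u`, counted from `1`. -/
def pos (u x : V) : ℕ := (L.nbrs u).idxOf x + 1

theorem neighbor_eq_some_iff {u x : V} {i : ℕ} :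
    L.neighbor u i = some x ↔ x ∈ L.nbrs u ∧ L.pos u x = i := by
  unfold neighbor pos
  rcases i with _ | i
  · simp
  · simp only [Nat.succ_ne_zero, if_false, Nat.add_sub_cancel, add_left_inj]
    rw [List.getElem?_eq_some_iff]
    constructor
    · rintro ⟨h, rfl⟩
      exact ⟨List.getElem_mem h, (L.nodup u).idxOf_getElem i h⟩
    · rintro ⟨hx, rfl⟩
      exact ⟨List.idxOf_lt_length_of_mem hx, List.getElem_idxOf _⟩

theorem pos_le_degree {u x : V} (h : x ∈ L.nbrs u) : L.pos u x ≤ L.degree u :=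
  List.idxOf_lt_length_of_mem h

theorem adjacency_eq {u x : V} (h : x ∈ L.nbrs u) : L.adjacency u x = some (L.pos u x) :=
  if_pos h

end IncidenceList

/-! ### The algorithm as a tree of coins, none flipped twice -/

/-- The coins of the analysis: `inl e` decides whether the edge `e` is kept, and `inr (u, x)` is
flipped when a search from `u` passes a neighbor `x` whose edge to `u` is already decided. -/
abbrev Coin (V : Type*) := Sym2 V ⊕ V × V

/-- The end of a query on `u` with degree `d` when the index `i` and the neighbor `x` were found. -/
def outputProg {V : Type*} (u : V) (d i : ℕ) (x : Option V) : Prog V (Option V) :=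
  .writeLast u i (.ret (if i ≤ d then x else none))

/-- The part of a query on `u` with degree `d` after the search, which stopped at the index `i`. -/
def finishProg {V : Type*} (u : V) (d w i : ℕ) : Prog V (Option V) :=
  .neighbor u i fun x =>
    if i ≠ w then
      match x with
      | none => outputProg u d i x
      | some y => .insertKnown u i (.adjacency y u fun
          | none => outputProg u d i x
          | some j => .insertKnown y j (outputProg u d i x))
    else outputProg u d i x

theorem nextNeighbor_eq {V : Type*} (u : V) :
    nextNeighbor u = .readLast u fun v => .degree u fun d => .leastKnown u v d fun w =>
      if v ≠ w then searchLoop u w (finishProg u d w) v else finishProg u d w v := rfl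

section Tree

variable {V : Type*} [DecidableEq V] {G : SimpleGraph V} (L : IncidenceList G)

/-- The coin that a search from `u` in the state `s` flips at the index `i`. -/
def coinAt (s : DataStr V) (u : V) (i : ℕ) : Coin V :=
  match L.neighbor u i with
  | none => .inr (u, u)
  | some x => if L.pos x u ≤ s.last x then .inr (u, x) else .inl s(u, x)

/-- The first of the coins `c (a + 1), …, c (a + g)` that shows `true`. -/
def scanTree {κ : Type*} (c : ℕ → κ) (a : ℕ) : ℕ → CoinTree κ ℕ
  | 0 => .ret (a + 1)
  | g + 1 => .flip (c (a + 1)) fun b => if b then .ret (a + 1) else scanTree c (a + 1) g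

/-- Execution of a program as a decision tree, where samples are made by a search from `u`. -/
def execTree {α : Type*} (u : V) : Prog V α → DataStr V → CoinTree (Coin V) (Outcome V α)
  | .ret a, s => .ret ⟨a, s, 0, 0⟩
  | .degree v k, s => (execTree u (k (L.degree v)) s).bind fun o => .ret o.addProbe
  | .neighbor v i k, s => (execTree u (k (L.neighbor v i)) s).bind fun o => .ret o.addProbe
  | .adjacency v x k, s => (execTree u (k (L.adjacency v x)) s).bind fun o => .ret o.addProbe
  | .sample a b k, s => (scanTree (coinAt L s u) a (b - a - 1)).bind fun i =>
      (execTree u (k i) s).bind fun o => .ret o.addStep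
  | .readLast v k, s => (execTree u (k (s.last v)) s).bind fun o => .ret o.addStep
  | .writeLast v i k, s =>
      (execTree u k { s with last := Function.update s.last v i }).bind fun o => .ret o.addStep
  | .leastKnown v a b k, s =>
      (execTree u (k (s.leastKnown v a b)) s).bind fun o => .ret o.addStep
  | .insertKnown v i k, s =>
      (execTree u k { s with known := Function.update s.known v (insert i (s.known v)) }).bind
        fun o => .ret o.addStep

/-- The interaction as a decision tree. -/
def interactTree (σ : List (QueryRecord V) → V) :
    ℕ → CoinTree (Coin V) (List (QueryRecord V) × DataStr V)
  | 0 => .ret ([], DataStr.init V)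
  | T + 1 => (interactTree σ T).bind fun hs =>
      (execTree L (σ hs.1) (nextNeighbor (σ hs.1)) hs.2).bind fun o =>
        .ret (hs.1 ++ [⟨σ hs.1, o.result, o.probes, o.steps⟩], o.state)

theorem law_scanTree {κ : Type*} (p : ℝ≥0) (hp : p ≤ 1) (c : ℕ → κ) (a g : ℕ) :
    (scanTree c a g).law p hp = firstKept p hp a g := by
  induction g generalizing a with
  | zero => rfl
  | succ g ih =>
    rw [scanTree, CoinTree.law, firstKept]
    congr 1
    funext b
    cases b
    · simpa using ih (a + 1)
    · rfl

theorem law_execTree {α : Type*} (p : ℝ≥0) (hp : p ≤ 1) (u : V) (prog : Prog V α)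
    (s : DataStr V) : (execTree L u prog s).law p hp = prog.exec L p hp s := by
  induction prog generalizing s with
  | ret a => rfl
  | sample a b k ih =>
    simp only [execTree, Prog.exec, CoinTree.law_bind, law_scanTree, ih, nextIndexLaw,
      PMF.map_bind]
    rfl
  | degree _ _ ih | neighbor _ _ _ ih | adjacency _ _ _ ih | readLast _ _ ih
  | writeLast _ _ _ ih | leastKnown _ _ _ _ ih | insertKnown _ _ _ ih =>
    simp only [execTree, Prog.exec, CoinTree.law_bind, ih]
    rfl

theorem law_interactTree (p : ℝ≥0) (hp : p ≤ 1) (σ : List (QueryRecord V) → V) (T : ℕ) :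
    (interactTree L σ T).law p hp = interact L p hp σ T := by
  induction T with
  | zero => rfl
  | succ T ih =>
    simp only [interactTree, interact, CoinTree.law_bind, law_execTree, ih]
    rfl

/-- The coins that were not yet flipped when every vertex `v` has been searched up to its index
`last v`. -/
def unread (last : V → ℕ) : Set (Coin V)
  | .inl e => e ∈ G.edgeSet ∧ ∀ u x, e = s(u, x) → last u < L.pos u x
  | .inr q => last q.1 < L.pos q.1 q.2

theorem unread_anti {last last' : V → ℕ} (h : last ≤ last') : unread L last' ⊆ unread L last := by
  rintro (e | q) hc
  · exact ⟨hc.1, fun u x he => (h u).trans_lt (hc.2 u x he)⟩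
  · exact (h q.1).trans_lt hc

theorem unread_update_anti (last : V → ℕ) (u : V) {i j : ℕ} (h : i ≤ j) :
    unread L (Function.update last u j) ⊆ unread L (Function.update last u i) :=
  unread_anti L (update_le_update_iff.2 ⟨h, fun _ _ => le_rfl⟩)

/-- An edge coin is chosen only if `x` has not passed `u`, and `u` has just not reached `x`; thus
neither endpoint has read it. A ghost coin is read only from its first vertex. -/
theorem coinAt_mem_unread (s : DataStr V) {u : V} {i : ℕ} (hi : i < L.degree u) :
    coinAt L s u (i + 1) ∈ unread L (Function.update s.last u i) := by
  obtain ⟨x, hx⟩ := L.exists_neighbor i.succ_pos hi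
  obtain ⟨hxu, hpos⟩ := L.neighbor_eq_some_iff.1 hx
  have hadj := (L.mem_iff u x).1 hxu
  have hu : Function.update s.last u i u < L.pos u x := by simp [hpos]
  rw [coinAt, hx]
  dsimp only
  split_ifs with h
  · exact hu
  · refine ⟨hadj, fun a b hab => ?_⟩
    rcases Sym2.eq_iff.1 hab with ⟨rfl, rfl⟩ | ⟨rfl, rfl⟩
    · exact hu
    · rw [Function.update_of_ne hadj.ne']
      exact not_le.1 h

theorem unread_subset_diff_coinAt (s : DataStr V) {u : V} {i : ℕ} (hi : i < L.degree u) :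
    unread L (Function.update s.last u (i + 1)) ⊆
      unread L (Function.update s.last u i) \ {coinAt L s u (i + 1)} := by
  obtain ⟨x, hx⟩ := L.exists_neighbor i.succ_pos hi
  obtain ⟨hxu, hpos⟩ := L.neighbor_eq_some_iff.1 hx
  refine Set.subset_sdiff_singleton (unread_update_anti L _ u i.le_succ) fun hc => ?_
  rw [coinAt, hx] at hc
  dsimp only at hc
  split_ifs at hc
  · have : Function.update s.last u (i + 1) u < L.pos u x := hc
    simp [hpos] at this
  · have := hc.2 u x rfl
    simp [hpos] at this

/-- The updated array records how far the scan has come, although the algorithm writes `last u` only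
at the end of the query; `coinAt` keeps using the old state `s`. -/
theorem fresh_scanTree (s : DataStr V) (u : V) (g : ℕ) {a : ℕ} (hg : a + g ≤ L.degree u)
    {K : Set (Coin V)} (hK : unread L (Function.update s.last u a) ⊆ K) :
    (scanTree (coinAt L s u) a g).Fresh
      (fun i K => a < i ∧ i ≤ a + g + 1 ∧ unread L (Function.update s.last u i) ⊆ K) K := by
  induction g generalizing a K with
  | zero => exact ⟨by omega, by omega, (unread_update_anti L _ u a.le_succ).trans hK⟩
  | succ g ih =>
    have ha : a < L.degree u := by omega
    have hK' := (unread_subset_diff_coinAt L s ha).trans (Set.sdiff_subset_sdiff_left hK)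
    refine ⟨hK (coinAt_mem_unread L s ha), fun b => ?_⟩
    cases b
    · exact (ih (by omega) hK').mono fun i K h => ⟨by omega, by omega, h.2.2⟩
    · exact ⟨by omega, by omega, hK'⟩

/-- The loop writes nothing, so `s` stays fixed while the supply shrinks. `Q` must ignore the cost
counters. -/
theorem fresh_searchLoop {α : Type*} (s : DataStr V) (u : V) (w : ℕ) (hw : w ≤ L.degree u + 1)
    (k : ℕ → Prog V α) {Q : Outcome V α → Set (Coin V) → Prop}
    (hQ : ∀ o K, Q o K → Q o.addProbe K ∧ Q o.addStep K)
    (hk : ∀ i ≤ w, ∀ K, unread L (Function.update s.last u i) ⊆ K →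
      (execTree L u (k i) s).Fresh Q K)
    (v : ℕ) (hv : v < w) {K : Set (Coin V)} (hK : unread L (Function.update s.last u v) ⊆ K) :
    (execTree L u (searchLoop u w k v) s).Fresh Q K := by
  induction hm : w - v using Nat.strong_induction_on generalizing v K with
  | _ m ih =>
    rw [searchLoop]
    refine (fresh_scanTree L s u (w - v - 1) (by omega) hK).bind fun i K hi => ?_
    obtain ⟨hvi, hiw, hK⟩ := hi
    refine CoinTree.Fresh.bind (Q := Q) ?_ fun o K h => (hQ o K h).2
    beta_reduce
    by_cases h : v < i ∧ i < w
    · rw [dif_pos h]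
      obtain ⟨x, hx⟩ := L.exists_neighbor (u := u) (i := i) (by omega) (by omega)
      have hxu := (L.neighbor_eq_some_iff.1 hx).1
      refine CoinTree.Fresh.bind (Q := Q) ?_ fun o K h => (hQ o K h).1
      simp only [hx]
      refine CoinTree.Fresh.bind (Q := Q) ?_ fun o K h => (hQ o K h).1
      simp only [L.adjacency_eq (L.mem_nbrs_comm.1 hxu)]
      refine CoinTree.Fresh.bind (Q := Q) ?_ fun o K h => (hQ o K h).2
      beta_reduce
      split_ifs
      · exact ih (w - i) (by omega) i h.2 hK rfl
      · exact hk i h.2.le K hK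
    · rw [dif_neg h]
      obtain rfl : i = w := by omega
      exact hk i le_rfl K hK

/-- The bound on `last` is part of the invariant because it ensures `s.last u ≤ w`. -/
theorem fresh_nextNeighbor (s : DataStr V) (u : V) (hs : ∀ v, s.last v ≤ L.degree v + 1)
    {K : Set (Coin V)} (hK : unread L s.last ⊆ K) :
    (execTree L u (nextNeighbor u) s).Fresh
      (fun o K => (∀ v, o.state.last v ≤ L.degree v + 1) ∧ unread L o.state.last ⊆ K) K := by
  set Q : Outcome V (Option V) → Set (Coin V) → Prop :=
    fun o K => (∀ v, o.state.last v ≤ L.degree v + 1) ∧ unread L o.state.last ⊆ K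
  have hQ : ∀ o K, Q o K → Q o.addProbe K ∧ Q o.addStep K := fun o K h => ⟨h, h⟩
  have hP : ∀ o K, Q o K → (CoinTree.ret o.addProbe : CoinTree (Coin V) _).Fresh Q K :=
    fun o K h => h
  have hS : ∀ o K, Q o K → (CoinTree.ret o.addStep : CoinTree (Coin V) _).Fresh Q K :=
    fun o K h => h
  rw [nextNeighbor_eq]
  refine CoinTree.Fresh.bind (Q := Q) ?_ hS
  refine CoinTree.Fresh.bind (Q := Q) ?_ hP
  refine CoinTree.Fresh.bind (Q := Q) ?_ hS
  set w := s.leastKnown u (s.last u) (L.degree u)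
  have hwd : w ≤ L.degree u + 1 := Finset.min'_le _ _ (Finset.mem_insert_self _ _)
  have hvw : s.last u ≤ w := by
    refine Finset.le_min' _ _ _ fun y hy => ?_
    rcases Finset.mem_insert.1 hy with rfl | hy
    · exact hs u
    · exact (Finset.mem_Ioc.1 (Finset.mem_inter.1 hy).2).1.le
  have hfin : ∀ (i : ℕ), i ≤ w → ∀ (known : V → Finset ℕ) (r : Option V) (K : Set (Coin V)),
      unread L (Function.update s.last u i) ⊆ K →
      (execTree L u (outputProg u (L.degree u) i r) ⟨s.last, known⟩).Fresh Q K := by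
    intro i hi known r K hK
    refine CoinTree.Fresh.bind (Q := Q) ⟨fun v => ?_, hK⟩ hS
    rcases eq_or_ne v u with rfl | h
    · simpa using hi.trans hwd
    · simpa [h] using hs v
  have hfinish : ∀ i ≤ w, ∀ K, unread L (Function.update s.last u i) ⊆ K →
      (execTree L u (finishProg u (L.degree u) w i) s).Fresh Q K := by
    intro i hi K hK
    refine CoinTree.Fresh.bind (Q := Q) ?_ hP
    beta_reduce
    split_ifs with hiw
    · rcases L.neighbor u i with _ | y
      · exact hfin i hi _ _ K hK
      · refine CoinTree.Fresh.bind (Q := Q) ?_ hS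
        refine CoinTree.Fresh.bind (Q := Q) ?_ hP
        beta_reduce
        rcases L.adjacency y u with _ | j
        · exact hfin i hi _ _ K hK
        · refine CoinTree.Fresh.bind (Q := Q) ?_ hS
          exact hfin i hi _ _ K hK
    · exact hfin i hi _ _ K hK
  have hK' : unread L (Function.update s.last u (s.last u)) ⊆ K := by
    rwa [Function.update_eq_self]
  beta_reduce
  split_ifs with h
  · exact fresh_searchLoop L s u w hwd _ hQ hfinish _ (lt_of_le_of_ne hvw h) hK'
  · exact hfinish _ hvw K hK'

theorem fresh_interactTree (σ : List (QueryRecord V) → V) (T : ℕ) {K : Set (Coin V)}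
    (hK : unread L (fun _ => 0) ⊆ K) :
    (interactTree L σ T).Fresh
      (fun hs K => (∀ v, hs.2.last v ≤ L.degree v + 1) ∧ unread L hs.2.last ⊆ K) K := by
  induction T with
  | zero => exact ⟨fun v => Nat.zero_le _, hK⟩
  | succ T ih =>
    refine ih.bind fun hs K h => ?_
    exact (fresh_nextNeighbor L hs.2 (σ hs.1) h.1 h.2).bind fun o K h => h

end Tree

theorem PMF.toOuterMeasure_univ {α : Type*} (q : PMF α) : q.toOuterMeasure Set.univ = 1 :=
  (q.toOuterMeasure_apply_eq_one_iff _).2 (Set.subset_univ _)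

/-! ### Geometric tail of the number of ghosts -/

section Ghosts

variable {V : Type*}

/-- Count the coins `inr (u, x)` that show `true`, along a list of neighbors `x` of `u`, before the
first edge of `u` that is kept. -/
def ghostTree (u : V) : List V → CoinTree (Coin V) ℕ
  | [] => .ret 0
  | x :: l => .flip (.inl s(u, x)) fun b => if b then .ret 0 else
      .flip (.inr (u, x)) fun b => (ghostTree u l).bind fun m => .ret (if b then m + 1 else m)

theorem fresh_ghostTree (u : V) {l : List V} (hl : l.Nodup) {K : Set (Coin V)}
    (hK : ∀ x ∈ l, .inl s(u, x) ∈ K ∧ .inr (u, x) ∈ K) :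
    (ghostTree u l).Fresh (fun _ _ => True) K := by
  induction l generalizing K with
  | nil => trivial
  | cons x l ih =>
    obtain ⟨hx, hl⟩ := List.nodup_cons.1 hl
    refine ⟨(hK x List.mem_cons_self).1, fun b => ?_⟩
    cases b
    · refine ⟨⟨(hK x List.mem_cons_self).2, by simp⟩, fun b => ?_⟩
      refine (ih hl fun y hy => ?_).bind fun _ _ h => h
      have hyx : y ≠ x := fun h => hx (h ▸ hy)
      have := hK y (List.mem_cons_of_mem _ hy)
      refine ⟨⟨⟨this.1, ?_⟩, by simp⟩, ⟨this.2, by simp⟩, ?_⟩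
      · rw [Set.mem_singleton_iff, Sum.inl.injEq, Sym2.congr_right]
        exact hyx
      · simpa using hyx
    · trivial

/-- With `q = 1 - p`, one neighbor ends the count with probability `p`, adds a ghost with
probability `q * p`, and changes nothing with probability `q * q`. Induction along the list turns
this into the inequality `q * (2 * p + q) ≤ 1`. -/
theorem law_ghostTree_le (p : ℝ≥0) (hp : p ≤ 1) (u : V) (l : List V) (k : ℕ) :
    ((ghostTree u l).law p hp).toOuterMeasure {m | k ≤ m} ≤ 2⁻¹ ^ k := by
  induction l generalizing k with
  | nil =>
    cases k <;> simp [ghostTree, CoinTree.law]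
  | cons x l ih =>
    rcases k with _ | k
    · rw [pow_zero, ← PMF.toOuterMeasure_univ]
      exact MeasureTheory.measure_mono (Set.subset_univ _)
    set q : ℝ≥0∞ := 1 - p with hq
    have hpq : (p : ℝ≥0∞) + q = 1 :=
      add_tsub_cancel_of_le (show (p : ℝ≥0∞) ≤ 1 by exact_mod_cast hp)
    have h1 : (((ghostTree u l).law p hp).bind fun m => PMF.pure (m + 1)).toOuterMeasure
        {m | k + 1 ≤ m} ≤ 2⁻¹ ^ k := by
      refine le_trans (le_of_eq ?_) (ih k)
      refine (PMF.toOuterMeasure_map_apply (fun m => m + 1) ((ghostTree u l).law p hp) _).trans ?_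
      congr 1
      ext m
      exact Nat.succ_le_succ_iff
    have h0 : (((ghostTree u l).law p hp).bind fun m => PMF.pure m).toOuterMeasure
        {m | k + 1 ≤ m} ≤ 2⁻¹ ^ (k + 1) := by
      rw [PMF.bind_pure]
      exact ih (k + 1)
    have htwo : (2 : ℝ≥0∞)⁻¹ * 2 = 1 := ENNReal.inv_mul_cancel (by simp) (by simp)
    simp only [ghostTree, CoinTree.law, coin_bind_toOuterMeasure, if_true, Bool.false_eq_true,
      if_false, CoinTree.law_bind, ← hq]
    have hz : (PMF.pure 0 : PMF ℕ).toOuterMeasure {m | k + 1 ≤ m} = 0 := by simp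
    rw [hz, mul_zero, zero_add]
    calc q * (p * _ + q * _) ≤ q * (p * 2⁻¹ ^ k + q * 2⁻¹ ^ (k + 1)) := by gcongr
      _ = 2⁻¹ ^ k * (q * ((2⁻¹ * 2) * p + q * 2⁻¹)) := by rw [htwo]; ring
      _ = 2⁻¹ ^ (k + 1) * (q * (2 * p + q)) := by ring
      -- Adding `p * p` completes the square `(p + q) ^ 2 = 1`.
      _ ≤ 2⁻¹ ^ (k + 1) * (p * p + q * (2 * p + q)) := by gcongr; exact le_add_self
      _ = 2⁻¹ ^ (k + 1) * (p + q) ^ 2 := by ring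
      _ = 2⁻¹ ^ (k + 1) := by rw [hpq]; ring

variable [DecidableEq V]

/-- The number of coins `inr (u, x)` in `ω`, along a list of neighbors `x` of `u`, before the first
edge of `u` in `ω`. -/
def ghosts (ω : Finset (Coin V)) (u : V) (l : List V) : ℕ := (ghostTree u l).eval ω

theorem ghosts_cons_of_notMem {ω : Finset (Coin V)} {u x : V} (h : .inl s(u, x) ∉ ω) (l : List V) :
    ghosts ω u (x :: l) = if .inr (u, x) ∈ ω then ghosts ω u l + 1 else ghosts ω u l := by
  simp [ghosts, ghostTree, CoinTree.eval, CoinTree.eval_bind, h]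

end Ghosts

/-! ### The search loop for coins fixed in advance -/

section Eval

variable {V : Type*} [DecidableEq V] {G : SimpleGraph V} (L : IncidenceList G)
  (ω : Finset (Coin V))

/-- No neighbor of `u` with index strictly between `a` and `b` is joined to `u` by an edge in `ω`. -/
def EdgeFree (u : V) (a b : ℕ) : Prop :=
  ∀ x ∈ L.nbrs u, a < L.pos u x → L.pos u x < b → .inl s(u, x) ∉ ω

variable {L ω}

theorem ghosts_drop_succ {u x : V} {a : ℕ} (hx : L.neighbor u (a + 1) = some x)
    (h : .inl s(u, x) ∉ ω) :
    ghosts ω u ((L.nbrs u).drop a) = if .inr (u, x) ∈ ω then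
      ghosts ω u ((L.nbrs u).drop (a + 1)) + 1 else ghosts ω u ((L.nbrs u).drop (a + 1)) := by
  rw [L.neighbor_succ] at hx
  obtain ⟨ha, rfl⟩ := List.getElem?_eq_some_iff.1 hx
  rw [List.drop_eq_getElem_cons ha, ghosts_cons_of_notMem h]

/-- The count stops at the first kept edge. Over an edge-free stretch it does not stop, so a later
start can only lose ghosts. -/
theorem EdgeFree.ghosts_drop_le {u : V} {a b : ℕ} (hab : a ≤ b) (h : EdgeFree L ω u a (b + 1)) :
    ghosts ω u ((L.nbrs u).drop b) ≤ ghosts ω u ((L.nbrs u).drop a) := by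
  induction b, hab using Nat.le_induction with
  | base => rfl
  | succ b hab ih =>
    refine le_trans ?_ (ih fun x hx h1 h2 => h x hx h1 (by omega))
    rcases le_or_gt (L.degree u) b with hb | hb
    · have h1 : (L.nbrs u).drop b = [] := List.drop_eq_nil_of_le hb
      have h2 : (L.nbrs u).drop (b + 1) = [] := List.drop_eq_nil_of_le (Nat.le_succ_of_le hb)
      rw [h1, h2]
    · obtain ⟨x, hx⟩ := L.exists_neighbor b.succ_pos hb
      obtain ⟨hxu, hpos⟩ := L.neighbor_eq_some_iff.1 hx
      rw [ghosts_drop_succ hx (h x hxu (by omega) (by omega))]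
      split_ifs <;> omega

theorem EdgeFree.filter_take {u : V} {a b : ℕ} (hab : a ≤ b) (h : EdgeFree L ω u a (b + 1)) :
    ((L.nbrs u).take b).filter (fun x => .inl s(u, x) ∈ ω) =
      ((L.nbrs u).take a).filter (fun x => .inl s(u, x) ∈ ω) := by
  induction b, hab using Nat.le_induction with
  | base => rfl
  | succ b hab ih =>
    rw [← ih fun x hx h1 h2 => h x hx h1 (by omega), List.take_add_one, List.filter_append,
      ← L.neighbor_succ]
    rcases hx : L.neighbor u (b + 1) with _ | x
    · simp
    · obtain ⟨hxu, hpos⟩ := L.neighbor_eq_some_iff.1 hx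
      simp [h x hxu (by omega) (by omega)]

theorem eval_scanTree {κ : Type*} [DecidableEq κ] (ω : Finset κ) (c : ℕ → κ) (a g : ℕ) :
    a < (scanTree c a g).eval ω ∧ (scanTree c a g).eval ω ≤ a + g + 1 ∧
      (∀ j, a < j → j < (scanTree c a g).eval ω → c j ∉ ω) ∧
      ((scanTree c a g).eval ω ≤ a + g → c ((scanTree c a g).eval ω) ∈ ω) := by
  induction g generalizing a with
  | zero =>
    simp only [scanTree, CoinTree.eval]
    exact ⟨by omega, by omega, fun j _ _ => by omega, fun _ => by omega⟩
  | succ g ih =>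
    simp only [scanTree, CoinTree.eval]
    by_cases h : c (a + 1) ∈ ω
    · simp only [h, decide_true, if_true, CoinTree.eval]
      exact ⟨by omega, by omega, fun j _ _ => by omega, fun _ => trivial⟩
    · simp only [h, decide_false, Bool.false_eq_true, if_false]
      obtain ⟨h1, h2, h3, h4⟩ := ih (a + 1)
      refine ⟨by omega, by omega, fun j hj hj' => ?_, fun h => h4 (by omega)⟩
      rcases eq_or_ne j (a + 1) with rfl | hne
      · exact h
      · exact h3 j (by omega) hj'

theorem probes_le_steps {α : Type*} (u : V) (prog : Prog V α) (s : DataStr V) :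
    ((execTree L u prog s).eval ω).probes ≤ ((execTree L u prog s).eval ω).steps := by
  induction prog generalizing s with
  | ret a => exact le_rfl
  | sample a b k ih =>
    simp only [execTree, CoinTree.eval_bind, CoinTree.eval, Outcome.addStep]
    exact Nat.le_succ_of_le (ih _ _)
  | degree _ _ ih | neighbor _ _ _ ih | adjacency _ _ _ ih =>
    simp only [execTree, CoinTree.eval_bind, CoinTree.eval, Outcome.addProbe]
    exact Nat.succ_le_succ (ih _ _)
  | readLast _ _ ih | leastKnown _ _ _ _ ih =>
    simp only [execTree, CoinTree.eval_bind, CoinTree.eval, Outcome.addStep]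
    exact Nat.le_succ_of_le (ih _ _)
  | writeLast _ _ _ ih | insertKnown _ _ _ ih =>
    simp only [execTree, CoinTree.eval_bind, CoinTree.eval, Outcome.addStep]
    exact Nat.le_succ_of_le (ih _)

variable (L ω)

/-- The data structure agrees with the edges in `ω`. -/
structure Consistent (s : DataStr V) : Prop where
  last_le : ∀ u, s.last u ≤ L.degree u + 1
  known : ∀ u, ∀ i ∈ s.known u, ∃ x, L.neighbor u i = some x ∧ .inl s(u, x) ∈ ω ∧
    L.pos x u ∈ s.known x
  passed : ∀ u, ∀ x ∈ L.nbrs u, L.pos u x ≤ s.last u → .inl s(u, x) ∈ ω → L.pos x u ∈ s.known x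

variable {L ω}

/-- Had `x` passed `u`, the kept edge would be known to `u`; so the coin read here is the edge coin,
and a scan cannot skip a kept edge. -/
theorem Consistent.coinAt_mem_of_edge {s : DataStr V} (hs : Consistent L ω s) {u x : V}
    (hx : x ∈ L.nbrs u) (hk : L.pos u x ∉ s.known u) (he : .inl s(u, x) ∈ ω) :
    coinAt L s u (L.pos u x) ∈ ω := by
  rw [coinAt, L.neighbor_eq_some_iff.2 ⟨hx, rfl⟩]
  dsimp only
  rw [if_neg]
  · exact he
  · exact fun h => hk (hs.passed x u (L.mem_nbrs_comm.1 hx) h (by rwa [Sym2.eq_swap]))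

/-- A round costs four steps: sample, two probes and a read of `last`. Each rejected round uses up
one ghost; the extra `1` pays for the final round. -/
theorem Consistent.eval_searchLoop {α : Type*} {s : DataStr V} (hs : Consistent L ω s) {u : V}
    {w : ℕ} (hw : w ≤ L.degree u + 1) (hwk : w ≤ L.degree u → w ∈ s.known u)
    (k : ℕ → Prog V α) (v : ℕ) (hv : v < w) (hun : ∀ j, v < j → j < w → j ∉ s.known u) :
    ∃ i, v < i ∧ i ≤ w ∧ EdgeFree L ω u v i ∧
      (∀ x, L.neighbor u i = some x → .inl s(u, x) ∈ ω) ∧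
      ((execTree L u (searchLoop u w k v) s).eval ω).result =
        ((execTree L u (k i) s).eval ω).result ∧
      ((execTree L u (searchLoop u w k v) s).eval ω).state =
        ((execTree L u (k i) s).eval ω).state ∧
      ((execTree L u (searchLoop u w k v) s).eval ω).steps ≤
        ((execTree L u (k i) s).eval ω).steps + 4 * (ghosts ω u ((L.nbrs u).drop v) + 1) := by
  induction hm : w - v using Nat.strong_induction_on generalizing v with
  | _ m ih =>
    rw [searchLoop]
    simp only [execTree, CoinTree.eval_bind, CoinTree.eval]
    obtain ⟨hvi, hiw, hbefore, hat⟩ := eval_scanTree ω (coinAt L s u) v (w - v - 1)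
    set i := (scanTree (coinAt L s u) v (w - v - 1)).eval ω
    have hfree : EdgeFree L ω u v i := fun x hx h1 h2 he =>
      hbefore _ h1 h2 (hs.coinAt_mem_of_edge hx (hun _ h1 (by omega)) he)
    by_cases h : v < i ∧ i < w
    · rw [dif_pos h]
      obtain ⟨x, hx⟩ := L.exists_neighbor (u := u) (i := i) (by omega) (by omega)
      obtain ⟨hxu, hpos⟩ := L.neighbor_eq_some_iff.1 hx
      have hcoin := hat (by omega)
      rw [coinAt, hx] at hcoin
      simp only [execTree, CoinTree.eval_bind, CoinTree.eval, hx,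
        L.adjacency_eq (L.mem_nbrs_comm.1 hxu)]
      dsimp only at hcoin
      split_ifs at hcoin ⊢ with hd
      -- Here `x` has passed `u`. If the edge were kept, `i` would be a known index below `w`.
      · have hne : .inl s(u, x) ∉ ω := fun he =>
          hun i hvi h.2 (hpos ▸ hs.passed x u (L.mem_nbrs_comm.1 hxu) hd (by rwa [Sym2.eq_swap]))
        obtain ⟨i', h1, h2, h3, h4, h5, h6, h7⟩ := ih (w - i) (by omega) i h.2
          (fun j hj => hun j (by omega)) rfl
        have hghost : ghosts ω u ((L.nbrs u).drop i) + 1 ≤ ghosts ω u ((L.nbrs u).drop v) := by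
          -- Indices count from `1`, so `drop j` begins with the neighbor of index `j + 1`, whose
          -- ghost is the one used up.
          obtain ⟨j, hj⟩ : ∃ j, i = j + 1 := ⟨i - 1, by omega⟩
          rw [hj] at hx hfree ⊢
          refine le_trans (le_of_eq ?_) (hfree.ghosts_drop_le (by omega))
          rw [ghosts_drop_succ hx hne, if_pos hcoin]
        refine ⟨i', by omega, h2, fun y hy hy1 hy2 => ?_, h4, h5, h6, ?_⟩
        · rcases lt_trichotomy (L.pos u y) i with hlt | heq | hgt
          · exact hfree y hy hy1 hlt
          · have := L.neighbor_eq_some_iff.2 ⟨hy, heq⟩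
            rw [hx, Option.some_inj] at this
            rwa [← this]
          · exact h3 y hy hgt hy2
        · simp only [Outcome.addStep, Outcome.addProbe]
          omega
      · refine ⟨i, hvi, h.2.le, hfree, fun y hy => ?_, rfl, rfl, ?_⟩
        · rw [hx, Option.some_inj] at hy
          rwa [← hy]
        · simp only [Outcome.addStep, Outcome.addProbe]
          omega
    · rw [dif_neg h]
      have hiw : i = w := by omega
      refine ⟨w, by omega, le_rfl, hiw ▸ hfree, fun y hy => ?_, rfl, rfl, ?_⟩
      -- If `w` is the index of a neighbor at all, it is a known index, hence a kept edge.
      · obtain ⟨hyu, hpos⟩ := L.neighbor_eq_some_iff.1 hy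
        obtain ⟨x, hx, he, -⟩ := hs.known u w (hwk (hpos ▸ L.pos_le_degree hyu))
        rw [hy, Option.some_inj] at hx
        rwa [hx]
      · simp only [Outcome.addStep]
        omega

end Eval

/-! ### Queries and whole runs for coins fixed in advance -/

section Query

variable {V : Type*} [DecidableEq V] {G : SimpleGraph V} {L : IncidenceList G}
  {ω : Finset (Coin V)}

theorem eval_outputProg (s : DataStr V) (u : V) (d i : ℕ) (x : Option V) :
    (execTree L u (outputProg u d i x) s).eval ω =
      ⟨if i ≤ d then x else none, ⟨Function.update s.last u i, s.known⟩, 0, 1⟩ := rfl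

theorem mem_update_insert {known : V → Finset ℕ} {u v : V} {i j : ℕ} :
    j ∈ Function.update known u (insert i (known u)) v ↔ j ∈ known v ∨ v = u ∧ j = i := by
  rcases eq_or_ne v u with rfl | h
  · simp [or_comm]
  · simp [h]

theorem eval_finishProg (s : DataStr V) (u : V) {w i : ℕ} (h0 : 0 < i) (hi : i ≤ w)
    (hw : w ≤ L.degree u + 1) :
    ∃ known : V → Finset ℕ,
      ((execTree L u (finishProg u (L.degree u) w i) s).eval ω).result = L.neighbor u i ∧
      ((execTree L u (finishProg u (L.degree u) w i) s).eval ω).state =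
        ⟨Function.update s.last u i, known⟩ ∧
      ((execTree L u (finishProg u (L.degree u) w i) s).eval ω).steps ≤ 5 ∧
      ∀ v j, j ∈ known v ↔ j ∈ s.known v ∨
        i ≠ w ∧ ∃ y, L.neighbor u i = some y ∧ (v = u ∧ j = i ∨ v = y ∧ j = L.pos y u) := by
  have hres : (if i ≤ L.degree u then L.neighbor u i else none) = L.neighbor u i := by
    split_ifs with h
    · rfl
    · rw [L.neighbor_eq_none (not_le.1 h)]
  rcases eq_or_ne i w with rfl | hiw
  · refine ⟨s.known, ?_⟩
    simp [finishProg, execTree, CoinTree.eval_bind, CoinTree.eval, Outcome.addProbe,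
      eval_outputProg, hres]
  · obtain ⟨y, hy⟩ := L.exists_neighbor (u := u) h0 (by omega)
    have hyu := (L.neighbor_eq_some_iff.1 hy).1
    have hid : i ≤ L.degree u := by omega
    simp only [finishProg, execTree, CoinTree.eval_bind, CoinTree.eval, hiw, ne_eq,
      not_false_eq_true, if_true, hy, L.adjacency_eq (L.mem_nbrs_comm.1 hyu), eval_outputProg,
      Outcome.addProbe, Outcome.addStep, hid, true_and]
    refine ⟨_, rfl, le_rfl, fun v j => ?_⟩
    rw [mem_update_insert, mem_update_insert]
    simp [or_assoc]

/-- What a query does when the coins are flipped in advance: it moves to the next edge in `ω`, and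
its cost is governed by the number of ghosts that it passes. -/
theorem Consistent.eval_nextNeighbor {s : DataStr V} (hs : Consistent L ω s) (u : V) :
    Consistent L ω ((execTree L u (nextNeighbor u) s).eval ω).state ∧
      (∀ v ≠ u, ((execTree L u (nextNeighbor u) s).eval ω).state.last v = s.last v) ∧
      ((L.nbrs u).take (((execTree L u (nextNeighbor u) s).eval ω).state.last u)).filter
          (fun x => .inl s(u, x) ∈ ω) =
        ((L.nbrs u).take (s.last u)).filter (fun x => .inl s(u, x) ∈ ω) ++
          ((execTree L u (nextNeighbor u) s).eval ω).result.toList ∧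
      (((execTree L u (nextNeighbor u) s).eval ω).result = none →
        L.degree u < ((execTree L u (nextNeighbor u) s).eval ω).state.last u) ∧
      ((execTree L u (nextNeighbor u) s).eval ω).steps ≤
        4 * ghosts ω u ((L.nbrs u).drop (s.last u)) + 12 := by
  rw [nextNeighbor_eq]
  simp only [execTree, CoinTree.eval_bind, CoinTree.eval, Outcome.addStep, Outcome.addProbe]
  have hmem : s.leastKnown u (s.last u) (L.degree u) ∈
      insert (L.degree u + 1) (s.known u ∩ Finset.Ioc (s.last u) (L.degree u)) :=
    Finset.min'_mem _ _
  have hmin : ∀ j ∈ insert (L.degree u + 1) (s.known u ∩ Finset.Ioc (s.last u) (L.degree u)),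
      s.leastKnown u (s.last u) (L.degree u) ≤ j := fun j hj => Finset.min'_le _ _ hj
  set w := s.leastKnown u (s.last u) (L.degree u)
  have hwd : w ≤ L.degree u + 1 := hmin _ (Finset.mem_insert_self _ _)
  have hlast := hs.last_le u
  have hcase : w = L.degree u + 1 ∨ w ∈ s.known u ∧ s.last u < w ∧ w ≤ L.degree u := by
    simpa using hmem
  have hun : ∀ j, s.last u < j → j < w → j ∉ s.known u := fun j h1 h2 hj => by
    have := hmin j (Finset.mem_insert_of_mem (Finset.mem_inter.2
      ⟨hj, Finset.mem_Ioc.2 ⟨h1, by omega⟩⟩))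
    omega
  have hwk : w ≤ L.degree u → w ∈ s.known u := fun h => by
    rcases hcase with h' | h'
    · omega
    · exact h'.1
  obtain ⟨i, o, ho, h0, hvi, hvi', hiw, hfree, hedge, hres, hstate, hsteps⟩ :
      ∃ i o, o = (execTree L u (if s.last u ≠ w then
            searchLoop u w (finishProg u (L.degree u) w) (s.last u)
          else finishProg u (L.degree u) w (s.last u)) s).eval ω ∧ 0 < i ∧ s.last u ≤ i ∧
        (i = s.last u → i = L.degree u + 1) ∧ i ≤ w ∧
        EdgeFree L ω u (s.last u) i ∧ (∀ x, L.neighbor u i = some x → .inl s(u, x) ∈ ω) ∧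
        o.result = ((execTree L u (finishProg u (L.degree u) w i) s).eval ω).result ∧
        o.state = ((execTree L u (finishProg u (L.degree u) w i) s).eval ω).state ∧
        o.steps ≤ ((execTree L u (finishProg u (L.degree u) w i) s).eval ω).steps +
          4 * (ghosts ω u ((L.nbrs u).drop (s.last u)) + 1) := by
    by_cases h : s.last u ≠ w
    · rw [if_pos h]
      obtain ⟨i, h1, h2, h3⟩ := hs.eval_searchLoop hwd hwk (finishProg u (L.degree u) w) (s.last u)
        (by omega) hun
      exact ⟨i, _, rfl, by omega, h1.le, by omega, h2, h3⟩
    · rw [if_neg h]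
      -- A known `w` lies strictly beyond `s.last u`, so equality means that the list is exhausted.
      have hd : s.last u = L.degree u + 1 := by omega
      refine ⟨s.last u, _, rfl, by omega, le_rfl, fun _ => hd, by omega,
        fun x hx h1 h2 => by omega, fun x hx => ?_, rfl, rfl, by omega⟩
      rw [L.neighbor_eq_none (by omega)] at hx
      simp at hx
  rw [← ho]
  obtain ⟨known, fres, fstate, fsteps, hknown⟩ := eval_finishProg (L := L) (ω := ω) s u h0 hiw hwd
  rw [hstate, hres, fres, fstate]
  refine ⟨⟨fun v => ?_, fun v j hj => ?_, fun v x hx hp he => ?_⟩, fun v hv => by simp [hv], ?_,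
    fun hnone => ?_, by omega⟩
  · rcases eq_or_ne v u with rfl | h
    · simpa using hiw.trans hwd
    · simpa [h] using hs.last_le v
  · dsimp only at hj ⊢
    rcases (hknown v j).1 hj with hj | ⟨hne, y, hy, ⟨rfl, rfl⟩ | ⟨rfl, rfl⟩⟩
    · obtain ⟨x, h1, h2, h3⟩ := hs.known v j hj
      exact ⟨x, h1, h2, (hknown _ _).2 (.inl h3)⟩
    · exact ⟨y, hy, hedge y hy, (hknown _ _).2 (.inr ⟨hne, y, hy, .inr ⟨rfl, rfl⟩⟩)⟩
    · obtain ⟨hyu, hpos⟩ := L.neighbor_eq_some_iff.1 hy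
      refine ⟨u, L.neighbor_eq_some_iff.2 ⟨L.mem_nbrs_comm.1 hyu, rfl⟩, ?_, ?_⟩
      · rw [Sym2.eq_swap]
        exact hedge _ hy
      · exact (hknown _ _).2 (.inr ⟨hne, _, hy, .inl ⟨rfl, hpos⟩⟩)
  · dsimp only at hp ⊢
    rw [hknown]
    rcases eq_or_ne v u with rfl | h
    · rw [Function.update_self] at hp
      rcases le_or_gt (L.pos v x) (s.last v) with hv | hv
      · exact .inl (hs.passed v x hx hv he)
      · rcases hp.lt_or_eq with hlt | heq
        · exact absurd he (hfree x hx hv hlt)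
        · have hnb := L.neighbor_eq_some_iff.2 ⟨hx, heq⟩
          rcases eq_or_ne i w with hiw | hiw
          · obtain ⟨y, h1, -, h3⟩ := hs.known v w (hwk (hiw ▸ heq ▸ L.pos_le_degree hx))
            rw [← hiw, hnb, Option.some_inj] at h1
            exact .inl (h1 ▸ h3)
          · exact .inr ⟨hiw, x, hnb, .inr ⟨rfl, rfl⟩⟩
    · rw [Function.update_of_ne h] at hp
      exact .inl (hs.passed v x hx hp he)
  · dsimp only
    rw [Function.update_self]
    rcases eq_or_lt_of_le hvi with h | h
    · rw [← h, L.neighbor_eq_none (by rw [hvi' h.symm] at h; omega)]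
      simp
    · obtain ⟨j, rfl⟩ : ∃ j, i = j + 1 := ⟨i - 1, by omega⟩
      rw [List.take_add_one, List.filter_append, hfree.filter_take (by omega), ← L.neighbor_succ]
      congr 1
      rcases hx : L.neighbor u (j + 1) with _ | x
      · simp
      · simp [hedge x hx]
  · dsimp only at hnone ⊢
    rw [Function.update_self]
    by_contra hle
    obtain ⟨x, hx⟩ := L.exists_neighbor h0 (not_lt.1 hle)
    simp [hx] at hnone

theorem queriesOn_append_singleton (u : V) (h : List (QueryRecord V)) (r : QueryRecord V) :
    queriesOn u (h ++ [r]) = queriesOn u h ++ if r.vertex = u then [r] else [] := by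
  simp [queriesOn, List.filter_append, List.filter_singleton]

/-- When the coins are flipped in advance, the answers are those of the graph of all edges in `ω`,
and the costs are governed by the number of ghosts. -/
theorem eval_interactTree (ω : Finset (Coin V)) {H : SimpleGraph V}
    (hH : ∀ u, ∀ x ∈ L.nbrs u, H.Adj u x ↔ .inl s(u, x) ∈ ω) (σ : List (QueryRecord V) → V)
    (T : ℕ) :
    Consistent L ω ((interactTree L σ T).eval ω).2 ∧
      (∀ u, ((L.nbrs u).take (((interactTree L σ T).eval ω).2.last u)).filter
          (fun x => .inl s(u, x) ∈ ω) =
        (L.nbrsIn H u).take (queriesOn u ((interactTree L σ T).eval ω).1).length) ∧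
      AnswersFrom L H ((interactTree L σ T).eval ω).1 ∧
      ∀ r ∈ ((interactTree L σ T).eval ω).1, r.probes ≤ r.steps ∧ ∃ u a,
        r.steps ≤ 4 * ghosts ω u ((L.nbrs u).drop a) + 12 := by
  have hN : ∀ u, L.nbrsIn H u = (L.nbrs u).filter (fun x => .inl s(u, x) ∈ ω) := fun u =>
    List.filter_congr fun x hx => by simp [hH u x hx]
  induction T with
  | zero =>
    refine ⟨⟨fun u => Nat.zero_le _, fun u i hi => ?_, fun u x _ hx => ?_⟩, fun u => ?_,
      fun u t r hr => ?_, fun r hr => ?_⟩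
    · simp [interactTree, CoinTree.eval, DataStr.init] at hi
    · simp [interactTree, CoinTree.eval, DataStr.init, IncidenceList.pos] at hx
    · simp [interactTree, CoinTree.eval, DataStr.init, queriesOn]
    · simp [interactTree, CoinTree.eval, queriesOn] at hr
    · simp [interactTree, CoinTree.eval] at hr
  | succ T ih =>
    simp only [interactTree, CoinTree.eval_bind, CoinTree.eval]
    set hs := (interactTree L σ T).eval ω
    obtain ⟨hcons, hfilter, hans, hcost⟩ := ih
    set u := σ hs.1
    obtain ⟨h1, h2, h3, hnone, h4⟩ := hcons.eval_nextNeighbor u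
    have h5 := probes_le_steps (L := L) (ω := ω) u (nextNeighbor u) hs.2
    set o := (execTree L u (nextNeighbor u) hs.2).eval ω
    have hnext : o.result = (L.nbrsIn H u)[(queriesOn u hs.1).length]? := by
      rw [hfilter] at h3
      rcases hy : o.result with _ | y
      -- The pointer is past the list, so everything was already returned and the query count is at
      -- least `|N(u)|`.
      · rw [hy, List.take_of_length_le (hnone hy).le, ← hN, Option.toList_none,
          List.append_nil] at h3
        exact (List.getElem?_eq_none (List.take_eq_self_iff _ |>.1 h3.symm)).symm
      · rw [hy, Option.toList_some] at h3
        have hpre : (L.nbrsIn H u).take (queriesOn u hs.1).length ++ [y] <+: L.nbrsIn H u := by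
          rw [← h3, hN]
          exact (List.take_prefix _ _).filter _
        -- One more element still fits into the neighborhood, which forces the query count below its
        -- length.
        have hlen := hpre.length_le
        rw [List.length_append, List.length_singleton, List.length_take] at hlen
        obtain ⟨l, hl⟩ := hpre
        have hget : ((L.nbrsIn H u).take (queriesOn u hs.1).length ++ [y] ++ l)[
            (queriesOn u hs.1).length]? = some y := by
          rw [List.append_assoc, List.getElem?_append_right (by rw [List.length_take]; omega),
            List.length_take, min_eq_left (by omega)]
          simp
        rw [hl] at hget
        exact hget.symm
    refine ⟨h1, fun v => ?_, fun v t r hr => ?_, fun r hr => ?_⟩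
    · rw [queriesOn_append_singleton]
      by_cases hv : u = v
      · subst hv
        rw [if_pos rfl, List.length_append, List.length_singleton, List.take_add_one, h3, hfilter,
          hnext]
      · rw [if_neg hv, List.append_nil, h2 v (Ne.symm hv), hfilter]
    · rw [queriesOn_append_singleton] at hr
      by_cases hv : u = v
      · subst hv
        rw [if_pos rfl] at hr
        rcases lt_trichotomy t (queriesOn u hs.1).length with ht | ht | ht
        · rw [List.getElem?_append_left ht] at hr
          exact hans u t r hr
        · subst ht
          simp only [List.getElem?_concat_length, Option.some_inj] at hr
          rw [← hr]
          exact hnext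
        · rw [List.getElem?_eq_none (by simp; omega)] at hr
          simp at hr
      · rw [if_neg hv, List.append_nil] at hr
        exact hans v t r hr
    · rcases List.mem_append.1 hr with hr | hr
      · exact hcost r hr
      · rw [List.mem_singleton.1 hr]
        exact ⟨h5, u, hs.2.last u, h4⟩

end Query

/-! ### Union bound over vertices and starting indices -/

section Union

variable {V : Type*} [Fintype V] [DecidableEq V] {G : SimpleGraph V} (L : IncidenceList G)

theorem subsetLaw_ghosts_le (p : ℝ≥0) (hp : p ≤ 1) {K : Finset (Sym2 V)}
    (hK : ∀ e, e ∈ K ↔ e ∈ G.edgeSet) {k : ℕ} (hk : 0 < k) :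
    (subsetLaw p hp (K.disjSum (Finset.univ : Finset (V × V)))).toOuterMeasure
        {ω | ∃ u a, k ≤ ghosts ω u ((L.nbrs u).drop a)} ≤
      Fintype.card V * (Fintype.card V * 2⁻¹ ^ k) := by
  have hsub : {ω | ∃ u a, k ≤ ghosts ω u ((L.nbrs u).drop a)} ⊆
      ⋃ u, ⋃ a : Fin (Fintype.card V), {ω | k ≤ ghosts ω u ((L.nbrs u).drop a)} := by
    rintro ω ⟨u, a, h⟩
    -- From `a = Fintype.card V` on, the remaining list is empty and has no ghosts; thus `n`
    -- starting indices suffice.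
    rcases lt_or_ge a (Fintype.card V) with ha | ha
    · exact Set.mem_iUnion.2 ⟨u, Set.mem_iUnion.2 ⟨⟨a, ha⟩, h⟩⟩
    · rw [List.drop_eq_nil_of_le ((L.nodup u).length_le_card.trans ha)] at h
      exact absurd (Nat.le_zero.1 h) hk.ne'
  have hone : ∀ u a, (subsetLaw p hp (K.disjSum (Finset.univ : Finset (V × V)))).toOuterMeasure
      {ω | k ≤ ghosts ω u ((L.nbrs u).drop a)} ≤ 2⁻¹ ^ k := by
    intro u a
    refine le_trans (le_of_eq ?_) (law_ghostTree_le p hp u ((L.nbrs u).drop a) k)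
    rw [← (fresh_ghostTree u ((L.nodup u).sublist (List.drop_sublist _ _)) fun x hx =>
      ?_).map_eval p hp (K := K.disjSum Finset.univ), PMF.toOuterMeasure_map_apply]
    · rfl
    · simpa [hK] using (L.mem_iff u x).1 (List.mem_of_mem_drop hx)
  refine (MeasureTheory.measure_mono hsub).trans ?_
  refine (MeasureTheory.measure_iUnion_fintype_le _ _).trans
    ((Finset.sum_le_sum fun u _ => (MeasureTheory.measure_iUnion_fintype_le _ _).trans
      (Finset.sum_le_sum fun a _ => hone u a.1)).trans (le_of_eq ?_))
  simp [nsmul_eq_mul]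

/-- The `2` in `d + 2` pays for the `n ^ 2` events of the union bound. -/
theorem card_mul_card_mul_inv_two_pow_le {n k : ℕ} {d : ℝ} (hn : 2 ≤ n)
    (hk : (d + 2) * Real.log n / Real.log 2 ≤ k) :
    (n : ℝ≥0∞) * (n * 2⁻¹ ^ k) ≤ ENNReal.ofReal ((n : ℝ) ^ (-d)) := by
  have hn0 : (0 : ℝ) < n := by positivity
  have hlog2 : 0 < Real.log 2 := Real.log_pos one_lt_two
  have hpow : (2⁻¹ : ℝ) ^ k ≤ (n : ℝ) ^ (-(d + 2)) := by
    rw [← Real.rpow_natCast, Real.rpow_def_of_pos (by norm_num), Real.rpow_def_of_pos hn0,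
      Real.exp_le_exp, Real.log_inv]
    rw [div_le_iff₀ hlog2] at hk
    linarith
  have hreal : (n : ℝ) * (n * 2⁻¹ ^ k) ≤ (n : ℝ) ^ (-d) := by
    calc (n : ℝ) * (n * 2⁻¹ ^ k) ≤ n * (n * (n : ℝ) ^ (-(d + 2))) := by gcongr
      _ = (n : ℝ) ^ (2 : ℝ) * (n : ℝ) ^ (-(d + 2)) := by
        rw [Real.rpow_two]; ring
      _ = (n : ℝ) ^ (-d) := by
        rw [← Real.rpow_add hn0]; congr 1; ring
  refine le_trans (le_of_eq ?_) (ENNReal.ofReal_le_ofReal hreal)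
  rw [ENNReal.ofReal_mul hn0.le, ENNReal.ofReal_mul hn0.le, ENNReal.ofReal_natCast,
    ENNReal.ofReal_pow (by positivity), ENNReal.ofReal_inv_of_pos two_pos, ENNReal.ofReal_ofNat]

end Union

/-! ### Recovering a whole neighborhood, and the coupling -/

theorem AnswersFrom.map_answer_take {V : Type*} [DecidableEq V] {G : SimpleGraph V}
    {L : IncidenceList G} {H : SimpleGraph V} {h : List (QueryRecord V)} (hans : AnswersFrom L H h)
    {u : V} (hu : (L.nbrsIn H u).length + 1 ≤ (queriesOn u h).length) :
    ((queriesOn u h).take ((L.nbrsIn H u).length + 1)).map QueryRecord.answer =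
      (L.nbrsIn H u).map some ++ [none] := by
  refine List.ext_getElem (by simpa using hu) fun t h1 h2 => ?_
  have ht : t < (queriesOn u h).length := by
    simp only [List.length_map, List.length_take] at h1
    omega
  rw [List.getElem_map, List.getElem_take, hans u t _ (List.getElem?_eq_getElem ht)]
  rcases lt_or_ge t (L.nbrsIn H u).length with hlt | hge
  · rw [List.getElem_append_left (by simpa using hlt), List.getElem_map,
      List.getElem?_eq_getElem hlt]
  · rw [List.getElem_append_right (by simpa using hge), List.getElem?_eq_none hge,
      List.getElem_singleton]

theorem sum_map_take_le {α : Type*} (f : α → ℕ) (l : List α) (m : ℕ) {c b : ℝ} (hcb : 0 ≤ c * b)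
    (h : ∀ r ∈ l.take (m + 1), (f r : ℝ) ≤ c * b) :
    ((((l.take (m + 1)).map f).sum : ℕ) : ℝ) ≤ c * (m + 1) * b := by
  have hsum : ∀ l : List α, (∀ r ∈ l, (f r : ℝ) ≤ c * b) →
      (((l.map f).sum : ℕ) : ℝ) ≤ l.length * (c * b) := by
    intro l
    induction l with
    | nil => simp
    | cons x l ih =>
      intro hl
      have h1 := hl x List.mem_cons_self
      have h2 := ih fun r hr => hl r (List.mem_cons_of_mem _ hr)
      simp only [List.map_cons, List.sum_cons, List.length_cons, Nat.cast_add, Nat.cast_one]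
      linarith
  have hlen : ((l.take (m + 1)).length : ℝ) ≤ m + 1 := by
    exact_mod_cast List.length_take_le _ _
  calc _ ≤ ((l.take (m + 1)).length : ℝ) * (c * b) := hsum _ h
    _ ≤ (m + 1) * (c * b) := by gcongr
    _ = c * (m + 1) * b := by ring

theorem mainTheorem5 (d : ℝ) (hd : 0 < d) :
    ∃ C : ℝ, 0 < C ∧
      ∀ {V : Type*} [Fintype V] [DecidableEq V] (_hn : 2 ≤ Fintype.card V)
        (G : SimpleGraph V) (L : IncidenceList G) (p : ℝ≥0) (hp : p ≤ 1)
        (σ : List (QueryRecord V) → V) (T : ℕ),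
        ∃ μ : PMF (SimpleGraph V × List (QueryRecord V)),
          -- a coupling of the random skeleton with the run of the algorithm
          μ.map Prod.fst = skeletonLaw G p hp ∧
          μ.map Prod.snd = transcriptLaw L p hp σ T ∧
          -- the answers are always those of next-neighbor access to that skeleton, and
          -- `|N(u)| + 1` queries on `u` return all of its neighbor list `N(u)`, and then `⊥`
          (∀ ω ∈ μ.support, AnswersFrom L ω.1 ω.2 ∧
            ∀ u, (L.nbrsIn ω.1 u).length + 1 ≤ (queriesOn u ω.2).length →
              ((queriesOn u ω.2).take ((L.nbrsIn ω.1 u).length + 1)).map QueryRecord.answer =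
                (L.nbrsIn ω.1 u).map some ++ [none]) ∧
          -- with high probability, every query is cheap, and so is the recovery of every `N(u)`
          1 - ENNReal.ofReal ((Fintype.card V : ℝ) ^ (-d)) ≤
            μ.toOuterMeasure {ω |
              (∀ r ∈ ω.2, (r.probes : ℝ) ≤ C * Real.log (Fintype.card V) ∧
                (r.steps : ℝ) ≤ C * Real.log (Fintype.card V)) ∧
              ∀ u, (L.nbrsIn ω.1 u).length + 1 ≤ (queriesOn u ω.2).length →
                let q := (queriesOn u ω.2).take ((L.nbrsIn ω.1 u).length + 1)
                (((q.map QueryRecord.probes).sum : ℕ) : ℝ) ≤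
                    C * ((L.nbrsIn ω.1 u).length + 1) * Real.log (Fintype.card V) ∧
                  (((q.map QueryRecord.steps).sum : ℕ) : ℝ) ≤
                    C * ((L.nbrsIn ω.1 u).length + 1) * Real.log (Fintype.card V)} := by

  have hlog2 : 0 < Real.log 2 := Real.log_pos one_lt_two
  -- Fewer than `k` ghosts cost at most `4 * k + 12` steps. Rounding up in `k` adds `4`, and the
  -- resulting `16` is absorbed since `Real.log 2 ≤ Real.log n`.
  refine ⟨(4 * (d + 2) + 16) / Real.log 2, by positivity, ?_⟩
  intro V _ _ hn G L p hp σ T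
  classical
  set n := Fintype.card V
  set C : ℝ := (4 * (d + 2) + 16) / Real.log 2 with hC
  have hlogn : Real.log 2 ≤ Real.log n := Real.log_le_log two_pos (by exact_mod_cast hn)
  have hlogn0 : 0 < Real.log n := hlog2.trans_le hlogn
  set k := ⌈(d + 2) * Real.log n / Real.log 2⌉₊
  have hk0 : 0 < k := Nat.ceil_pos.2 (by positivity)
  have hk1 : (d + 2) * Real.log n / Real.log 2 ≤ k := Nat.le_ceil _
  have hk2 : (k : ℝ) < (d + 2) * Real.log n / Real.log 2 + 1 := Nat.ceil_lt_add_one (by positivity)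
  have hkC : 4 * (k : ℝ) + 12 ≤ C * Real.log n := by
    have h1 : 1 ≤ Real.log n / Real.log 2 := (one_le_div hlog2).2 hlogn
    have h2 : C * Real.log n = 4 * ((d + 2) * Real.log n / Real.log 2) +
        16 * (Real.log n / Real.log 2) := by rw [hC]; ring
    linarith
  have hC0 : 0 < C := by positivity
  set E : Finset (Sym2 V) := Finset.univ.filter (· ∈ G.edgeSet) with hE
  have hEmem : ∀ e, e ∈ E ↔ e ∈ G.edgeSet := fun e => by simp [hE]
  set ν := subsetLaw p hp (E.disjSum (Finset.univ : Finset (V × V)))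
  let skel : Finset (Coin V) → SimpleGraph V := fun ω =>
    SimpleGraph.fromEdgeSet (ω.toLeft : Set (Sym2 V))
  have hskel : ∀ ω u, ∀ x ∈ L.nbrs u, (skel ω).Adj u x ↔ .inl s(u, x) ∈ ω := by
    intro ω u x hx
    have hne := ((L.mem_iff u x).1 hx).ne
    simp [skel, hne]
  have hrun : ν.map (fun ω => (interactTree L σ T).eval ω) = interact L p hp σ T := by
    rw [← law_interactTree]
    refine (fresh_interactTree L σ T fun c hc => ?_).map_eval p hp
    rcases c with e | q
    · simpa [hEmem] using hc.1
    · simp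
  refine ⟨ν.map fun ω => (skel ω, ((interactTree L σ T).eval ω).1), ?_, ?_, ?_, ?_⟩
  · rw [PMF.map_comp, skeletonLaw, keptEdgesLaw_eq_subsetLaw p hp G hEmem,
      ← map_toLeft_subsetLaw p hp E (Finset.univ : Finset (V × V))]
    change _ = PMF.map _ (PMF.map (fun S : Finset (Sym2 V) => (S : Set (Sym2 V))) _)
    rw [PMF.map_comp, PMF.map_comp]
    rfl
  · rw [PMF.map_comp, transcriptLaw, ← hrun, PMF.map_comp]
    rfl
  · intro ω' hω'
    obtain ⟨ω, -, rfl⟩ := (PMF.mem_support_map_iff _ _ _).1 hω'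
    have hans := (eval_interactTree ω (hskel ω) σ T).2.2.1
    exact ⟨hans, fun u hu => hans.map_answer_take hu⟩
  · rw [PMF.toOuterMeasure_map_apply, tsub_le_iff_right, ← PMF.toOuterMeasure_univ ν]
    refine le_trans ?_ (add_le_add_right ((subsetLaw_ghosts_le L p hp hEmem hk0).trans
      (card_mul_card_mul_inv_two_pow_le hn hk1)) _)
    -- Outside the event that some pair has at least `k` ghosts, every query is cheap; the bounds
    -- for whole neighborhoods are sums of these.
    refine le_trans (MeasureTheory.measure_mono fun ω _ => ?_) (MeasureTheory.measure_union_le _ _)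
    by_cases hbad : ∃ u a, k ≤ ghosts ω u ((L.nbrs u).drop a)
    · exact .inr hbad
    left
    push Not at hbad
    have hcost : ∀ r ∈ ((interactTree L σ T).eval ω).1,
        (r.probes : ℝ) ≤ C * Real.log n ∧ (r.steps : ℝ) ≤ C * Real.log n := by
      intro r hr
      obtain ⟨h1, u, a, h2⟩ := (eval_interactTree ω (hskel ω) σ T).2.2.2 r hr
      have h3 : r.steps ≤ 4 * k + 12 := h2.trans (by have := hbad u a; omega)
      have h4 : (r.steps : ℝ) ≤ 4 * k + 12 := by exact_mod_cast h3
      have h5 : (r.probes : ℝ) ≤ r.steps := by exact_mod_cast h1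
      exact ⟨by linarith, by linarith⟩
    refine ⟨hcost, fun u _ => ?_⟩
    dsimp only
    have hmem : ∀ r ∈ (queriesOn u ((interactTree L σ T).eval ω).1).take
        ((L.nbrsIn (skel ω) u).length + 1), r ∈ ((interactTree L σ T).eval ω).1 := fun r hr =>
      List.mem_of_mem_filter (List.mem_of_mem_take hr)
    exact ⟨sum_map_take_le _ _ _ (by positivity) fun r hr => (hcost r (hmem r hr)).1,
      sum_map_take_le _ _ _ (by positivity) fun r hr => (hcost r (hmem r hr)).2⟩
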